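/- Let $\mathcal{T}$ be the infinite rooted binary tree, with vertices the finite words over $\{0,1\}$, and let $G=\langle a,b,c,d\rangle\le \mathrm{Aut}(\mathcal{T})$ be the Grigorchuk group, where $a$ exchanges the two subtrees below the root ($a(xw)=(1-x)w$ for $x\in\{0,1\}$) and $b,c,d$ fix the first level and are given recursively by $b=(a,c)$, $c=(a,d)$, $d=(1,b)$; here $(g,h)$ acts as $g$ on the left subtree and as $h$ on the right subtree, i.e. $(g,h)(0w)=0\,g(w)$ and $(g,h)(1w)=1\,h(w)$. An ET0L system consists of a finite alphabet $V$, a subset $A\subseteq V$ of terminal symbols, a finite set $T$ of tables, each a finite subset of $V\times V^*$, and a finite set $I\subseteq V^*$ of starting words. If a table $t$ contains no pair with first entry $c\in V$, then the rule $(c,c)$ is understood to belong to $t$. For $t\in T$ write $u\to^t v$ if $u=c_1\cdots c_m$ with $c_j \in V$ and $v=v_1\cdots v_m$ with every $(c_j,v_j)$ a rule of $t$; write $u\to v$ if $u\to^t v$ for some $t\in T$, and let $\to^*$ be the reflexive transitive closure of $\to$. The language generated by the system is $\{v\in A^* : w\to^* v \text{ for some } w\in I\}$, and a language over $A$ is called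 ET0L if it is generated by such a system. **Theorem.** The co-word problem of the Grigorchuk group, that is, the set of words $w\in\{a,b,c,d\}^*$ that represent a non-trivial element of $G$, is an ET0L language over $\{a,b,c,d\}$. -/

import Mathlib

/-! ### ET0L systems and ET0L languages -/

/-- A table over the alphabet `V`: a finite set of rules `(c, v)`, with `c` a letter and `v` a
word. -/
abbrev RewriteTable (V : Type) := Finset (V × List V)

/-- `t.Rule c v` : the rule `c ⟶ v` is available in the table `t`. By convention, a letter for
which the table lists no rule has the rule `c ⟶ c`. -/
def RewriteTable.Rule {V : Type} (t : RewriteTable V) (c : V) (v : List V) : Prop :=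
  (c, v) ∈ t ∨ ((∀ v' : List V, (c, v') ∉ t) ∧ v = [c])

/-- Parallel rewriting `u ⟶ᵗ v`: if `u = c₁ ⋯ cₘ`, then `v = v₁ ⋯ vₘ` where each
`cⱼ ⟶ vⱼ` is a rule of `t`. -/
def RewriteTable.Step {V : Type} (t : RewriteTable V) (u v : List V) : Prop :=
  ∃ vs : List (List V), List.Forall₂ t.Rule u vs ∧ v = vs.flatten

/-- An ET0L system with terminal alphabet `A` inside the extended alphabet `V` (the inclusion of
`A` in `V` is an embedding), with a finite set of tables and a finite set of starting words. -/
structure ET0LSystem (A V : Type) where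
  /-- the inclusion of the terminal alphabet in the extended alphabet -/
  terminal : A ↪ V
  /-- the finite set of tables -/
  tables : Finset (RewriteTable V)
  /-- the finite set of starting words -/
  start : Finset (List V)

/-- `u ⟶ v` : `v` is produced from `u` by one of the tables of the system. -/
def ET0LSystem.Step {A V : Type} (H : ET0LSystem A V) (u v : List V) : Prop :=
  ∃ t ∈ H.tables, t.Step u v

/-- The language generated by the system: the words over the terminal alphabet which can be
produced from a starting word in finitely many (possibly zero) steps. -/
def ET0LSystem.language {A V : Type} (H : ET0LSystem A V) : Language A :=
  {w : List A | ∃ u ∈ H.start, Relation.ReflTransGen H.Step u (w.map H.terminal)}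

/-- A language is ET0L if it is generated by an ET0L system over a finite alphabet. -/
def IsET0L {A : Type} (L : Language A) : Prop :=
  ∃ (V : Type) (_ : Finite V) (H : ET0LSystem A V), H.language = L

/-! ### The Grigorchuk group -/

/-- The automorphism group of the infinite rooted binary tree. The vertices are the finite words
over `Bool`, the root is the empty word, `false :: w` lies in the left and `true :: w` in the
right subtree below the root; `u` is an ancestor of `v` when `u` is a prefix of `v`. -/
abbrev BinaryTreeAut : Type :=
  ((· <+: ·) : List Bool → List Bool → Prop) ≃r ((· <+: ·) : List Bool → List Bool → Prop)

/-- The alphabet `{a, b, c, d}`. -/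
inductive GrigorchukLetter : Type
  | a
  | b
  | c
  | d
  deriving DecidableEq

namespace GrigorchukLetter

/-- The action of the four generators on the vertices of the tree: `a` exchanges the two
subtrees below the root, and `b = (a, c)`, `c = (a, d)`, `d = (1, b)`, where `(g, h)` acts as `g`
on the left and as `h` on the right subtree. -/
def act : GrigorchukLetter → List Bool → List Bool
  | _, [] => []
  | a, x :: w => (!x) :: w
  | b, false :: w => false :: act a w
  | b, true :: w => true :: act c w
  | c, false :: w => false :: act a w
  | c, true :: w => true :: act d w
  | d, false :: w => false :: w
  | d, true :: w => true :: act b w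

theorem act_act (g : GrigorchukLetter) (w : List Bool) : act g (act g w) = w := by
  induction w generalizing g with
  | nil => cases g <;> rfl
  | cons x w ih => cases g <;> cases x <;> simp [act, ih]

theorem act_prefix {u v : List Bool} (g : GrigorchukLetter) (h : u <+: v) :
    act g u <+: act g v := by
  induction u generalizing g v with
  | nil => cases g <;> simp [act]
  | cons x u ih =>
    cases v with
    | nil => simp at h
    | cons y v =>
      obtain ⟨rfl, huv⟩ := List.cons_prefix_cons.1 h
      cases g <;> cases x <;> simp [act, List.cons_prefix_cons, ih _ huv, huv]

/-- The four generators as automorphisms of the tree. -/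
def toAut (g : GrigorchukLetter) : BinaryTreeAut where
  toFun := act g
  invFun := act g
  left_inv := act_act g
  right_inv := act_act g
  map_rel_iff' := by
    intro u v
    refine ⟨fun h => ?_, act_prefix g⟩
    simpa [act_act] using act_prefix g h

end GrigorchukLetter

/-- The Grigorchuk group, the group of tree automorphisms generated by `a`, `b`, `c`, `d`. -/
def GrigorchukGroup : Subgroup BinaryTreeAut :=
  Subgroup.closure (Set.range GrigorchukLetter.toAut)

/-- The element of the Grigorchuk group given by a letter. -/
def GrigorchukLetter.toGroup (g : GrigorchukLetter) : GrigorchukGroup :=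
  ⟨g.toAut, Subgroup.subset_closure (Set.mem_range_self g)⟩

/-- The element of the Grigorchuk group represented by a word over `{a, b, c, d}`. -/
def GrigorchukGroup.eval (w : List GrigorchukLetter) : GrigorchukGroup :=
  (w.map GrigorchukLetter.toGroup).prod

/-- The co-word problem of the Grigorchuk group: the words that represent non-trivial
elements. -/
def grigorchukCoWordProblem : Language GrigorchukLetter :=
  {w : List GrigorchukLetter | GrigorchukGroup.eval w ≠ 1}

/-!
The idea is to run the decomposition `g = (g₀, g₁)` backwards. A word is non-trivial if and only
if it contains an odd number of letters `a`, and so moves the first level of the tree, or its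
action on one of the two subtrees below the root is non-trivial.

The system works with the four letters, a symbol `blank` that stands for the identity, and a
symbol `odd` that stands for an unspecified word with an odd number of letters `a`. It has three
tables, each consisting of all the rules with right-hand side of length at most three that are
correct in the following sense. The expansion table replaces a symbol by a word with the same
action (for `odd`: the same action on the first level). The section table of `s` replaces a symbol
`c` by a word `v` that fixes the vertex `s` and acts as `c` below it. The symbol `odd` occurs at
most once in a derived word, and all rules preserve non-triviality, which gives soundness
(`moves_of_mem_language`).

For completeness (`derivable_of_moves`), one inducts on the length of a non-trivial word `w`. If
the number of letters `a` in `w` is odd, then `w` is produced from `odd`. If `w` contains `x x`, or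
two neighbouring letters among `b, c, d`, then it is an expansion of a shorter word. Otherwise
the letter `a` alternates with letters of `{b, c, d}`, so that `w` is a product of blocks `y` and
`a y a` with `y ∈ {b, c, d}` (`exists_blocks`). Each block fixes the first level, and its section
at either vertex is a single letter or trivial; hence `w` is obtained by a section table from a
word in the letters and `blank`. Blanks can be inserted by expansions, so it suffices to
derive the word without its blanks, which is shorter than `w` as soon as `w` has two letters.
Cancelling first is what makes the blocks independent of one another, as parallel rewriting
requires: in a general word the subtree seen by a letter depends on the letters around it.
-/

/-- The extended alphabet of the system. -/
inductive GrigorchukSymbol : Type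
  /-- a terminal letter -/
  | letter (g : GrigorchukLetter)
  /-- a placeholder for the identity, which may stand for a letter with trivial section -/
  | blank
  /-- a placeholder for a word with an odd number of letters `a` -/
  | odd
  deriving DecidableEq

namespace GrigorchukSymbol

open GrigorchukLetter

instance : Finite GrigorchukLetter :=
  Finite.of_surjective (fun i : Fin 4 => ![a, b, c, d] i) fun g => by
    cases g
    exacts [⟨0, rfl⟩, ⟨1, rfl⟩, ⟨2, rfl⟩, ⟨3, rfl⟩]

instance : Finite GrigorchukSymbol :=
  Finite.of_surjective
    (fun x : Option (Option GrigorchukLetter) => x.elim odd fun y => y.elim blank letter)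
    fun c => by
      cases c with
      | letter g => exact ⟨some (some g), rfl⟩
      | blank => exact ⟨some none, rfl⟩
      | odd => exact ⟨none, rfl⟩

/-! ### The action of words on the tree -/

/-- The action of a symbol on the vertices. The symbol `odd` acts as `a`; only its action on the
first level is meaningful. -/
def act : GrigorchukSymbol → List Bool → List Bool
  | letter g, x => g.act x
  | blank, x => x
  | odd, x => GrigorchukLetter.act a x

/-- The action of a word: a left action, so that the last symbol acts first. -/
def wordAct (u : List GrigorchukSymbol) (x : List Bool) : List Bool :=
  u.foldr act x

@[simp] theorem wordAct_nil (x : List Bool) : wordAct [] x = x := rfl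

@[simp] theorem wordAct_cons (c : GrigorchukSymbol) (u : List GrigorchukSymbol) (x : List Bool) :
    wordAct (c :: u) x = act c (wordAct u x) := rfl

@[simp] theorem wordAct_append (u v : List GrigorchukSymbol) (x : List Bool) :
    wordAct (u ++ v) x = wordAct u (wordAct v x) := by
  simp [wordAct]

@[simp] theorem act_nil (c : GrigorchukSymbol) : act c [] = [] := by
  cases c with
  | letter g => cases g <;> rfl
  | blank => rfl
  | odd => rfl

@[simp] theorem wordAct_apply_nil (u : List GrigorchukSymbol) : wordAct u [] = [] := by
  induction u with
  | nil => rfl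
  | cons c u ih => simp [ih]

/-- A symbol moves the first level exactly if it is `a` or `odd`. -/
def flips (c : GrigorchukSymbol) : Bool := c = letter a ∨ c = odd

theorem act_singleton (c : GrigorchukSymbol) (s : Bool) : act c [s] = [s ^^ flips c] := by
  cases c with
  | letter g => cases g <;> cases s <;> rfl
  | blank => cases s <;> rfl
  | odd => cases s <;> rfl

theorem wordAct_singleton (u : List GrigorchukSymbol) (s : Bool) :
    wordAct u [s] = [s ^^ (u.countP flips).bodd] := by
  induction u with
  | nil => simp
  | cons c u ih =>
    rw [wordAct_cons, ih, act_singleton, List.countP_cons]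
    cases flips c <;> simp

theorem letter_act_length (g : GrigorchukLetter) (x : List Bool) :
    (g.act x).length = x.length := by
  induction x generalizing g with
  | nil => cases g <;> rfl
  | cons s x ih => cases g <;> cases s <;> simp [GrigorchukLetter.act, ih]

theorem wordAct_length (u : List GrigorchukSymbol) (x : List Bool) :
    (wordAct u x).length = x.length := by
  induction u with
  | nil => rfl
  | cons c u ih =>
    rw [wordAct_cons, ← ih]
    cases c <;> simp [act, letter_act_length]

theorem eval_apply (w : List GrigorchukLetter) (x : List Bool) :
    (GrigorchukGroup.eval w : BinaryTreeAut) x = wordAct (w.map letter) x := by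
  induction w with
  | nil => rfl
  | cons g w ih =>
    have h : GrigorchukGroup.eval (g :: w) = g.toGroup * GrigorchukGroup.eval w := by
      simp [GrigorchukGroup.eval]
    rw [h, List.map_cons, wordAct_cons, ← ih]
    rfl

theorem eval_ne_one_iff (w : List GrigorchukLetter) :
    GrigorchukGroup.eval w ≠ 1 ↔ ∃ x, wordAct (w.map letter) x ≠ x := by
  rw [← not_forall, not_iff_not]
  constructor
  · intro h x
    rw [← eval_apply, h]
    rfl
  · intro h
    apply Subtype.ext
    apply RelIso.ext
    intro x
    rw [eval_apply, h]
    rfl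

/-! ### The ET0L system -/

/-- The table of all the rules that satisfy `P` and have a right-hand side of length at most
three. -/
noncomputable def boundedTable (P : GrigorchukSymbol → List GrigorchukSymbol → Prop) :
    RewriteTable GrigorchukSymbol :=
  Set.Finite.toFinset (s := {r | r.2.length ≤ 3 ∧ P r.1 r.2})
    ((Set.finite_univ.prod (List.finite_length_le GrigorchukSymbol 3)).subset
      fun _ hr => ⟨trivial, hr.1⟩)

theorem mem_boundedTable {P : GrigorchukSymbol → List GrigorchukSymbol → Prop}
    {c : GrigorchukSymbol} {v : List GrigorchukSymbol} :
    (c, v) ∈ boundedTable P ↔ v.length ≤ 3 ∧ P c v := by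
  simp [boundedTable]

/-- The rules that replace a symbol by a word with the same action, where for `odd` only the action
on the first level counts. No rule increases the number of occurrences of `odd`. -/
noncomputable def expansionTable : RewriteTable GrigorchukSymbol :=
  boundedTable fun c v => v.count odd ≤ [c].count odd ∧
    ∀ x : List Bool, (c = odd → x.length ≤ 1) → wordAct v x = act c x

/-- The rules that replace a symbol `c` by a word which fixes the vertex `s` of the first level and
acts as `c` on the subtree below it. There is no rule for `odd`, which thus remains unchanged. -/
noncomputable def sectionTable (s : Bool) : RewriteTable GrigorchukSymbol :=
  boundedTable fun c v => c ≠ odd ∧ odd ∉ v ∧ ∀ x, wordAct v (s :: x) = s :: act c x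

/-- The system that generates the co-word problem of the Grigorchuk group. -/
noncomputable def grigorchukSystem : ET0LSystem GrigorchukLetter GrigorchukSymbol where
  terminal := ⟨letter, fun _ _ h => by injection h⟩
  tables := {expansionTable, sectionTable false, sectionTable true}
  start := {[odd], [letter b], [letter c], [letter d]}

theorem mem_tables {t : RewriteTable GrigorchukSymbol} :
    t ∈ grigorchukSystem.tables ↔ t = expansionTable ∨ ∃ s, t = sectionTable s := by
  simp [grigorchukSystem]

theorem singleton_mem_expansionTable (c : GrigorchukSymbol) : (c, [c]) ∈ expansionTable :=
  mem_boundedTable.2 ⟨by simp, le_rfl, fun _ _ => rfl⟩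

theorem expansionTable_rule {c : GrigorchukSymbol} {v : List GrigorchukSymbol} :
    expansionTable.Rule c v ↔ (c, v) ∈ expansionTable :=
  ⟨fun h => h.resolve_right fun h' => h'.1 _ (singleton_mem_expansionTable c), Or.inl⟩

theorem sectionTable_rule {s : Bool} {c : GrigorchukSymbol} {v : List GrigorchukSymbol} :
    (sectionTable s).Rule c v ↔ (c, v) ∈ sectionTable s ∨ c = odd ∧ v = [odd] := by
  constructor
  · rintro (h | ⟨h, rfl⟩)
    · exact Or.inl h
    · suffices c = odd from Or.inr ⟨this, by rw [this]⟩
      -- every other symbol has a rule, so that the default rule is not available to it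
      have rule {v} (h1 : v.length ≤ 3)
          (h2 : c ≠ odd ∧ odd ∉ v ∧ ∀ x, wordAct v (s :: x) = s :: act c x) : c = odd :=
        absurd (mem_boundedTable.2 ⟨h1, h2⟩) (h v)
      cases c with
      | odd => rfl
      | blank =>
        cases s
        · exact rule (v := [letter d]) (by simp) (by simp [act, GrigorchukLetter.act])
        · exact rule (v := [letter a, letter d, letter a]) (by simp)
            (by simp [act, GrigorchukLetter.act])
      | letter g =>
        cases s <;> cases g
        · exact rule (v := [letter b]) (by simp) (by simp [act, GrigorchukLetter.act])
        · exact rule (v := [letter a, letter d, letter a]) (by simp)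
            (by simp [act, GrigorchukLetter.act])
        · exact rule (v := [letter a, letter b, letter a]) (by simp)
            (by simp [act, GrigorchukLetter.act])
        · exact rule (v := [letter a, letter c, letter a]) (by simp)
            (by simp [act, GrigorchukLetter.act])
        · exact rule (v := [letter a, letter b, letter a]) (by simp)
            (by simp [act, GrigorchukLetter.act])
        · exact rule (v := [letter d]) (by simp) (by simp [act, GrigorchukLetter.act])
        · exact rule (v := [letter b]) (by simp) (by simp [act, GrigorchukLetter.act])
        · exact rule (v := [letter c]) (by simp) (by simp [act, GrigorchukLetter.act])
  · rintro (h | ⟨rfl, rfl⟩)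
    · exact Or.inl h
    · exact Or.inr ⟨fun v h => (mem_boundedTable.1 h).2.1 rfl, rfl⟩

/-! ### Soundness -/

/-- The invariant of all derivations: `odd` occurs at most once, and the word moves some vertex,
which lies on the first level if `odd` occurs. -/
def Moves (u : List GrigorchukSymbol) : Prop :=
  u.count odd ≤ 1 ∧ ∃ x : List Bool, (odd ∈ u → x.length ≤ 1) ∧ wordAct u x ≠ x

theorem count_flatten_le {u : List GrigorchukSymbol} {vs : List (List GrigorchukSymbol)}
    (h : List.Forall₂ expansionTable.Rule u vs) : vs.flatten.count odd ≤ u.count odd := by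
  induction h with
  | nil => simp
  | @cons c v u vs hcv _ ih =>
    have h1 := (mem_boundedTable.1 (expansionTable_rule.1 hcv)).2.1
    rw [List.flatten_cons, List.count_append, ← List.singleton_append (l := u),
      List.count_append]
    omega

theorem wordAct_expansion {u : List GrigorchukSymbol} {vs : List (List GrigorchukSymbol)}
    (h : List.Forall₂ expansionTable.Rule u vs) {x : List Bool} (hx : odd ∈ u → x.length ≤ 1) :
    wordAct vs.flatten x = wordAct u x := by
  induction h with
  | nil => rfl
  | @cons c v u vs hcv _ ih =>
    have h1 := (mem_boundedTable.1 (expansionTable_rule.1 hcv)).2.2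
    rw [List.flatten_cons, wordAct_append, ih fun h => hx (List.mem_cons_of_mem _ h),
      wordAct_cons]
    refine h1 _ fun hc => ?_
    rw [wordAct_length]
    exact hx (by simp [hc])

theorem count_flatten_section {s : Bool} {u : List GrigorchukSymbol}
    {vs : List (List GrigorchukSymbol)} (h : List.Forall₂ (sectionTable s).Rule u vs) :
    vs.flatten.count odd = u.count odd := by
  induction h with
  | nil => rfl
  | @cons c v u vs hcv _ ih =>
    rw [List.flatten_cons, List.count_append, ih, List.count_cons, add_comm]
    congr 1
    rcases sectionTable_rule.1 hcv with h | ⟨rfl, rfl⟩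
    · obtain ⟨-, h1, h2, -⟩ := mem_boundedTable.1 h
      simp [h1, List.count_eq_zero.2 h2]
    · simp

/-- The image of any symbol other than `odd` under a section table fixes the first level. -/
theorem bodd_countP_section {s : Bool} {u : List GrigorchukSymbol}
    {vs : List (List GrigorchukSymbol)} (h : List.Forall₂ (sectionTable s).Rule u vs) :
    (vs.flatten.countP flips).bodd = (u.count odd).bodd := by
  induction h with
  | nil => rfl
  | @cons c v u vs hcv _ ih =>
    have key : (v.countP flips).bodd = decide (c = odd) := by
      rcases sectionTable_rule.1 hcv with h | ⟨rfl, rfl⟩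
      · obtain ⟨-, h1, -, h3⟩ := mem_boundedTable.1 h
        have h4 := h3 []
        rw [wordAct_singleton] at h4
        cases s <;> simpa [h1] using h4
      · simp [flips]
    rw [List.flatten_cons, List.countP_append, Nat.bodd_add, ih, key, List.count_cons,
      Nat.bodd_add, Bool.xor_comm]
    by_cases hc : c = odd <;> simp [hc]

theorem wordAct_section {s : Bool} {u : List GrigorchukSymbol}
    {vs : List (List GrigorchukSymbol)} (h : List.Forall₂ (sectionTable s).Rule u vs)
    (hu : odd ∉ u) (x : List Bool) : wordAct vs.flatten (s :: x) = s :: wordAct u x := by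
  induction h with
  | nil => rfl
  | @cons c v u vs hcv _ ih =>
    rw [List.mem_cons, not_or] at hu
    rw [List.flatten_cons, wordAct_append, ih hu.2, wordAct_cons]
    rcases sectionTable_rule.1 hcv with h | ⟨rfl, -⟩
    · exact (mem_boundedTable.1 h).2.2.2 _
    · exact absurd rfl hu.1

theorem Moves.step {u v : List GrigorchukSymbol} (hu : Moves u) (h : grigorchukSystem.Step u v) :
    Moves v := by
  obtain ⟨hc, x, hx, hux⟩ := hu
  obtain ⟨t, ht, vs, hvs, rfl⟩ := h
  rcases mem_tables.1 ht with rfl | ⟨s, rfl⟩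
  · have h1 := count_flatten_le hvs
    refine ⟨h1.trans hc, x, fun h => hx ?_, by rwa [wordAct_expansion hvs hx]⟩
    exact List.count_pos_iff.1 ((List.count_pos_iff.2 h).trans_le h1)
  · have h1 := count_flatten_section hvs
    refine ⟨h1.trans_le hc, ?_⟩
    by_cases hu : odd ∈ u
    · -- the result has an odd number of symbols that move the first level
      have h2 : u.count odd = 1 := le_antisymm hc (List.count_pos_iff.2 hu)
      refine ⟨[false], by simp, ?_⟩
      rw [wordAct_singleton, bodd_countP_section hvs, h2]
      simp
    · refine ⟨s :: x, fun h => ?_, by rw [wordAct_section hvs hu]; simpa using hux⟩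
      exact absurd h (by rwa [← List.count_eq_zero, h1, List.count_eq_zero])

theorem moves_start {u : List GrigorchukSymbol} (h : u ∈ grigorchukSystem.start) : Moves u := by
  simp only [grigorchukSystem, Finset.mem_insert, Finset.mem_singleton] at h
  rcases h with rfl | rfl | rfl | rfl
  · exact ⟨by simp, [false], by simp, by simp [act, GrigorchukLetter.act]⟩
  · exact ⟨by simp, [false, false], by simp, by simp [act, GrigorchukLetter.act]⟩
  · exact ⟨by simp, [false, false], by simp, by simp [act, GrigorchukLetter.act]⟩
  · exact ⟨by simp, [true, false, false], by simp, by simp [act, GrigorchukLetter.act]⟩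

theorem moves_of_mem_language {w : List GrigorchukLetter} (h : w ∈ grigorchukSystem.language) :
    ∃ x, wordAct (w.map letter) x ≠ x := by
  obtain ⟨u, hu, hw⟩ := h
  have key : ∀ v, Relation.ReflTransGen grigorchukSystem.Step u v → Moves v := by
    intro v hv
    induction hv with
    | refl => exact moves_start hu
    | tail _ h ih => exact ih.step h
  obtain ⟨-, x, -, hx⟩ := key _ hw
  exact ⟨x, hx⟩

/-! ### Completeness -/

/-- The words over the extended alphabet that the system produces. -/
def Derivable (v : List GrigorchukSymbol) : Prop :=
  ∃ u ∈ grigorchukSystem.start, Relation.ReflTransGen grigorchukSystem.Step u v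

theorem Derivable.step {u v : List GrigorchukSymbol} (hu : Derivable u)
    (h : grigorchukSystem.Step u v) : Derivable v := by
  obtain ⟨w, hw, hwu⟩ := hu
  exact ⟨w, hw, hwu.tail h⟩

theorem forall₂_expansion_self (u : List GrigorchukSymbol) :
    List.Forall₂ expansionTable.Rule u (u.map fun c => [c]) := by
  rw [List.forall₂_map_right_iff, List.forall₂_same]
  exact fun c _ => Or.inl (singleton_mem_expansionTable c)

theorem flatten_map_singleton (u : List GrigorchukSymbol) : (u.map fun c => [c]).flatten = u := by
  induction u with
  | nil => rfl
  | cons c u ih => simp [ih]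

/-- An expansion rule may be applied to a single symbol, all others being kept. -/
theorem Derivable.expand {p q v : List GrigorchukSymbol} {c : GrigorchukSymbol}
    (h : Derivable (p ++ c :: q)) (hv : (c, v) ∈ expansionTable) : Derivable (p ++ v ++ q) := by
  refine h.step ⟨_, mem_tables.2 (Or.inl rfl),
    p.map (fun c => [c]) ++ v :: q.map (fun c => [c]), ?_, ?_⟩
  · exact List.rel_append (forall₂_expansion_self p) (.cons (Or.inl hv) (forall₂_expansion_self q))
  · simp [flatten_map_singleton]

/-- A word of length at most two that acts trivially may be inserted anywhere in a nonempty word: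
a neighbouring symbol expands to itself together with the inserted word. -/
theorem Derivable.insert {p q v : List GrigorchukSymbol} (h : Derivable (p ++ q))
    (hpq : p ++ q ≠ []) (hv : v.length ≤ 2) (hvo : odd ∉ v) (hv1 : ∀ x, wordAct v x = x) :
    Derivable (p ++ v ++ q) := by
  have h0 := List.count_eq_zero.2 hvo
  cases q with
  | cons c q =>
    have hc : (c, v ++ [c]) ∈ expansionTable :=
      mem_boundedTable.2 ⟨by simpa using Nat.succ_le_succ hv, by simp [h0], by simp [hv1]⟩
    simpa using h.expand hc
  | nil =>
    obtain ⟨p, c, rfl⟩ := (List.eq_nil_or_concat' p).resolve_left (by simpa using hpq)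
    have hc : (c, c :: v) ∈ expansionTable :=
      mem_boundedTable.2
        ⟨by simpa using Nat.succ_le_succ hv, by simp [List.count_cons, h0], by simp [hv1]⟩
    simpa using Derivable.expand (p := p) (q := []) (by simpa using h) hc

theorem odd_mem_expansionTable {v : List GrigorchukSymbol} (h1 : v.length ≤ 3)
    (h2 : v.count odd ≤ 1) (h3 : (v.countP flips).bodd = true) :
    (odd, v) ∈ expansionTable := by
  refine mem_boundedTable.2 ⟨h1, by simpa using h2, fun x hx => ?_⟩
  match x, hx rfl with
  | [], _ => simp
  | [s], _ => rw [wordAct_singleton, h3, act_singleton]; simp [flips]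

/-- Every word with an odd number of letters `a` can be produced from the symbol `odd`. -/
theorem Derivable.odd_word (w : List GrigorchukLetter) (hw : Odd (w.count a))
    {p q : List GrigorchukSymbol} (h : Derivable (p ++ odd :: q)) :
    Derivable (p ++ w.map letter ++ q) := by
  induction hn : w.length using Nat.strong_induction_on generalizing w p q with | _ n ih
  subst hn
  rcases w with _ | ⟨g, w⟩
  · simp at hw
  by_cases hg : g = a
  · subst hg
    rcases List.eq_nil_or_concat' w with rfl | ⟨m, g, rfl⟩
    · exact h.expand (odd_mem_expansionTable (by simp) (by simp) (by simp [flips]))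
    · by_cases hg : g = a
      · subst hg
        have h1 : Derivable (p ++ [letter a, odd, letter a] ++ q) :=
          h.expand (odd_mem_expansionTable (by simp) (by simp) (by simp [flips]))
        have h2 : Odd (m.count a) := by
          simpa [Nat.odd_add_one, parity_simps] using hw
        simpa using
          ih _ (by simp) m h2 (p := p ++ [letter a]) (q := letter a :: q) (by simpa using h1) rfl
      · have h1 : Derivable (p ++ [odd, letter g] ++ q) :=
          h.expand (odd_mem_expansionTable (by simp) (by simp) (by simp [flips, hg]))
        have h2 : Odd ((a :: m).count a) := by simpa [hg] using hw
        simpa using ih _ (by simp) (a :: m) h2 (p := p) (q := letter g :: q) (by simpa using h1) rfl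
  · have h1 : Derivable (p ++ [letter g, odd] ++ q) :=
      h.expand (odd_mem_expansionTable (by simp) (by simp) (by simp [flips, hg]))
    have h2 : Odd (w.count a) := by simpa [hg] using hw
    simpa using ih _ (by simp) w h2 (p := p ++ [letter g]) (q := q) (by simpa using h1) rfl

/-- A word without `odd` can be derived by deriving the word of its letters and inserting the
blanks. -/
theorem exists_letters {u : List GrigorchukSymbol} (hu : odd ∉ u) :
    ∃ w : List GrigorchukLetter, w.length ≤ u.length ∧
      (∀ x, wordAct (w.map letter) x = wordAct u x) ∧
      ∀ p : List GrigorchukSymbol, p ++ w.map letter ≠ [] → Derivable (p ++ w.map letter) →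
        Derivable (p ++ u) := by
  induction u with
  | nil => exact ⟨[], by simp, by simp, by simp⟩
  | cons c u ih =>
    rw [List.mem_cons, not_or] at hu
    obtain ⟨w, h1, h2, h3⟩ := ih hu.2
    cases c with
    | odd => exact absurd rfl hu.1
    | blank =>
      refine ⟨w, by simp; omega, by simp [h2, act], fun p hp h => ?_⟩
      have h4 := h.insert hp (v := [blank]) (by simp) (by simp) (by simp [act])
      simpa using h3 (p ++ [blank]) (by simp) h4
    | letter g =>
      refine ⟨g :: w, by simpa using h1, by simp [h2], fun p hp h => ?_⟩
      simpa using h3 (p ++ [letter g]) (by simp) (by simpa using h)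

/-- Two adjacent letters can be replaced by at most one. -/
def Cancels (x y : GrigorchukLetter) : Prop := x = y ∨ x ≠ a ∧ y ≠ a

/-- A pair of adjacent letters that can be cancelled represents the identity or a letter, as
`{1, b, c, d}` is the Klein four-group. -/
theorem Cancels.eq_nil_or_letter {x y : GrigorchukLetter} (h : Cancels x y) :
    (∀ z, wordAct [letter x, letter y] z = z) ∨
      ∃ g, ∀ z, wordAct [letter x, letter y] z = act (letter g) z := by
  have key : ∀ z : List Bool, b.act (c.act z) = d.act z ∧ c.act (b.act z) = d.act z ∧
      b.act (d.act z) = c.act z ∧ d.act (b.act z) = c.act z ∧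
      c.act (d.act z) = b.act z ∧ d.act (c.act z) = b.act z := by
    intro z
    induction z with
    | nil => simp [GrigorchukLetter.act]
    | cons s z ih =>
      cases s
      · simp [GrigorchukLetter.act, act_act]
      · simp [GrigorchukLetter.act, ih]
  by_cases hxy : x = y
  · subst hxy
    exact Or.inl fun z => by simp [act, act_act]
  · obtain ⟨hx, hy⟩ := h.resolve_left hxy
    right
    cases x <;> cases y <;> simp only [ne_eq, not_true_eq_false] at hx hy hxy
    exacts [⟨d, fun z => (key z).1⟩, ⟨c, fun z => (key z).2.2.1⟩, ⟨d, fun z => (key z).2.1⟩,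
      ⟨b, fun z => (key z).2.2.2.2.1⟩, ⟨c, fun z => (key z).2.2.2.1⟩,
      ⟨b, fun z => (key z).2.2.2.2.2⟩]

/-- The section of a letter other than `a` at a vertex `s` of the first level is again a letter,
or trivial. -/
theorem exists_section {g : GrigorchukLetter} (hg : g ≠ a) (s : Bool) :
    ∃ c : GrigorchukSymbol, c ≠ odd ∧ ∀ x, g.act (s :: x) = s :: act c x := by
  cases g with
  | a => exact absurd rfl hg
  | b =>
    exact ⟨letter (if s then c else a), by simp, by cases s <;> simp [GrigorchukLetter.act, act]⟩
  | c =>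
    exact ⟨letter (if s then d else a), by simp, by cases s <;> simp [GrigorchukLetter.act, act]⟩
  | d =>
    cases s
    · exact ⟨blank, by simp, by simp [GrigorchukLetter.act, act]⟩
    · exact ⟨letter b, by simp, by simp [GrigorchukLetter.act, act]⟩

/-- A word with an even number of letters `a` and no cancelling adjacent letters is a product of
blocks `y` and `a y a` with `y ≠ a`, and hence the result of a section table. -/
theorem exists_blocks (s : Bool) (w : List GrigorchukLetter) :
    (∃ p q x y, w = p ++ x :: y :: q ∧ Cancels x y) ∨ Odd (w.count a) ∨
    ∃ u : List GrigorchukSymbol, ∃ vs, List.Forall₂ (sectionTable s).Rule u vs ∧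
      w.map letter = vs.flatten ∧ odd ∉ u ∧ u.length ≤ w.length ∧
      (a ∈ w → u.length < w.length) := by
  match w with
  | [] => exact Or.inr (Or.inr ⟨[], [], .nil, by simp⟩)
  | g :: w =>
    by_cases hg : g = a
    · subst hg
      match w with
      | [] => simp
      | g :: w =>
        by_cases hg : g = a
        · exact Or.inl ⟨[], w, a, g, rfl, Or.inl hg.symm⟩
        · match w with
          | [] => simp [hg]
          | g' :: w =>
            by_cases hg' : g' = a
            · subst hg'
              rcases exists_blocks s w with ⟨p, q, x, y, rfl, h⟩ | h | ⟨u, vs, h1, h2, h3, h4, -⟩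
              · exact Or.inl ⟨a :: g :: a :: p, q, x, y, rfl, h⟩
              · exact Or.inr (Or.inl (by simpa [hg, parity_simps] using h))
              · obtain ⟨k, hk, hgk⟩ := exists_section hg (!s)
                refine Or.inr (Or.inr ⟨k :: u, [letter a, letter g, letter a] :: vs,
                  .cons (Or.inl (mem_boundedTable.2 ⟨by simp, hk, by simp, fun x => ?_⟩)) h1,
                  by simp [h2], by simp [h3, hk.symm], by simp; omega, by simp; omega⟩)
                simp [act, GrigorchukLetter.act, hgk]
            · exact Or.inl ⟨[a], w, g, g', rfl, Or.inr ⟨hg, hg'⟩⟩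
    · rcases exists_blocks s w with ⟨p, q, x, y, rfl, h⟩ | h | ⟨u, vs, h1, h2, h3, h4, h5⟩
      · exact Or.inl ⟨g :: p, q, x, y, rfl, h⟩
      · exact Or.inr (Or.inl (by simpa [hg] using h))
      · obtain ⟨k, hk, hgk⟩ := exists_section hg s
        refine Or.inr (Or.inr ⟨k :: u, [letter g] :: vs,
          .cons (Or.inl (mem_boundedTable.2 ⟨by simp, hk, by simp, hgk⟩)) h1,
          by simp [h2], by simp [h3, hk.symm], by simpa using h4, ?_⟩)
        simpa [Ne.symm hg] using h5

/-- The inductive step for a word with a cancelling pair: it is an expansion of a shorter word with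
the same action. -/
theorem derivable_of_cancels {p q : List GrigorchukLetter} {g g' : GrigorchukLetter}
    (h : Cancels g g')
    (ih : ∀ w : List GrigorchukLetter, w.length < (p ++ g :: g' :: q).length →
      (∃ x, wordAct (w.map letter) x ≠ x) → Derivable (w.map letter))
    (hw : ∃ x, wordAct ((p ++ g :: g' :: q).map letter) x ≠ x) :
    Derivable ((p ++ g :: g' :: q).map letter) := by
  obtain ⟨x, hx⟩ := hw
  have hsplit : (p ++ g :: g' :: q).map letter =
      p.map letter ++ [letter g, letter g'] ++ q.map letter := by simp
  rw [hsplit, wordAct_append, wordAct_append] at hx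
  rw [hsplit]
  rcases h.eq_nil_or_letter with h | ⟨k, h⟩
  · have h1 : wordAct (p.map letter ++ q.map letter) x ≠ x := by
      rwa [h, ← wordAct_append] at hx
    have h2 := ih (p ++ q) (by simp) ⟨x, by rwa [List.map_append]⟩
    rw [List.map_append] at h2
    exact h2.insert (fun h0 => h1 (by rw [h0]; rfl)) (by simp) (by simp) h
  · have h1 : wordAct ((p ++ k :: q).map letter) x ≠ x := by
      rwa [h, ← wordAct_cons, ← wordAct_append, ← List.map_cons, ← List.map_append] at hx
    have h2 := ih (p ++ k :: q) (by simp) ⟨x, h1⟩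
    rw [List.map_append, List.map_cons] at h2
    exact h2.expand (mem_boundedTable.2 ⟨by simp, by simp, fun z _ => h z⟩)

theorem derivable_of_moves (w : List GrigorchukLetter)
    (hw : ∃ x, wordAct (w.map letter) x ≠ x) : Derivable (w.map letter) := by
  induction hn : w.length using Nat.strong_induction_on generalizing w with | _ n ih
  subst hn
  replace ih := fun w' h hw' => ih _ h w' hw' rfl
  obtain ⟨x, hx⟩ := id hw
  obtain _ | ⟨s, x⟩ := x
  · simp at hx
  rcases exists_blocks s w with ⟨p, q, g, g', rfl, h⟩ | h | ⟨u, vs, h1, h2, h3, -, h5⟩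
  · exact derivable_of_cancels h ih hw
  · simpa using
      Derivable.odd_word w h (p := []) (q := []) ⟨[odd], by simp [grigorchukSystem], .refl⟩
  · by_cases ha : a ∈ w
    · obtain ⟨w', h6, h7, h8⟩ := exists_letters h3
      have h9 : wordAct (w'.map letter) x ≠ x := by
        rw [h2, wordAct_section h1 h3] at hx
        rw [h7]
        simpa using hx
      have h10 : Derivable u := by
        refine h8 [] (fun h0 => h9 ?_) (ih w' (h6.trans_lt (h5 ha)) ⟨x, h9⟩)
        rw [List.nil_append] at h0
        rw [h0]
        rfl
      exact h10.step ⟨_, mem_tables.2 (Or.inr ⟨s, rfl⟩), vs, h1, h2⟩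
    · match w with
      | [] => simp at hx
      | [g] =>
        refine ⟨_, ?_, .refl⟩
        cases g with
        | a => simp at ha
        | b | c | d => simp [grigorchukSystem]
      | g :: g' :: w =>
        simp only [List.mem_cons, not_or] at ha
        exact derivable_of_cancels (p := []) (Or.inr ⟨Ne.symm ha.1, Ne.symm ha.2.1⟩) ih hw

end GrigorchukSymbol

open GrigorchukSymbol in
theorem mainTheorem1 : IsET0L grigorchukCoWordProblem := by
  refine ⟨GrigorchukSymbol, inferInstance, grigorchukSystem, ?_⟩
  ext w
  refine ⟨fun h => (eval_ne_one_iff w).2 (moves_of_mem_language h), fun h => ?_⟩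
  exact derivable_of_moves w ((eval_ne_one_iff w).1 h)
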